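/- Let $\mathbb{D}$ be the open unit disk in $\mathbb{C}$, let $\phi$ be an analytic function on $\mathbb{D}$ with $\phi(\mathbb{D})\subseteq\mathbb{D}$, and let $\psi$ be an analytic function on $\mathbb{D}$. Let $X$ be a set of analytic functions on $\mathbb{D}$ (no linear or norm structure is assumed) that is automorphism invariant: $f\circ\alpha\in X$ whenever $f\in X$ and $\alpha$ is an automorphism of $\mathbb{D}$ (a bijective analytic selfmap of $\mathbb{D}$ with analytic inverse). Write $C_\phi f=f\circ\phi$ and $W_{\psi,\phi}f=\psi\cdot(f\circ\phi)$. Such a mapping is called invertible on $X$ if it maps $X$ into $X$ and, as a mapping $X\to X$, has a two-sided inverse. A function $g$ on $\mathbb{D}$ is a multiplier of $X$ if $gf\in X$ for every $f\in X$. (a) Suppose that (i) $C_\phi$ maps $X$ into $X$; (ii) $X$ contains a univalent function; (iii) $X$ contains a nonconstant function that is analytic on a neighborhood of the closed disk $\overline{\mathbb{D}}$; and (iv) there is a dense subset $S$ of the unit circle such that for each $\zeta\in S$ there is a function in $X$ that does not extend analytically to a neighborhood of $\zeta$. Then $C_\phi$ is invertible on $X$ if and only if $\phi$ is an automorphism of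 $\mathbb{D}$. (b) Suppose that (i) $W_{\psi,\phi}$ maps $X$ into $X$; (ii) $X$ contains a nonzero constant function; (iii) $X$ contains a function of the form $z\mapsto z+c$ for some constant $c$; and (iv) there is a dense subset $S$ of the unit circle such that for each $\zeta\in S$ there is a function in $X$ that does not extend analytically to a neighborhood of $\zeta$. Then $W_{\psi,\phi}$ is invertible on $X$ if and only if $\phi$ is an automorphism of $\mathbb{D}$, $\psi$ is a multiplier of $X$, and $\psi$ has no zeros in $\mathbb{D}$ and $1/\psi$ is a multiplier of $X$. -/

import Mathlib

open scoped Complex.UnitDisc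

namespace DiskOp

/-- `f` extends to an analytic function on the set `U` (used for open `U` containing the disk). -/
def ExtendsTo (f : 𝔻 → ℂ) (U : Set ℂ) : Prop :=
  ∃ F : ℂ → ℂ, AnalyticOnNhd ℂ F U ∧ ∀ z : 𝔻, F (z : ℂ) = f z

/-- `f` is an analytic function on the open unit disk. -/
def IsAnalytic (f : 𝔻 → ℂ) : Prop :=
  ExtendsTo f (Metric.ball (0 : ℂ) 1)

/-- `f` is analytic on a neighborhood of the closed unit disk. -/
def AnalyticOnClosedDisk (f : 𝔻 → ℂ) : Prop :=
  ∃ U : Set ℂ, IsOpen U ∧ Metric.closedBall (0 : ℂ) 1 ⊆ U ∧ ExtendsTo f U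

/-- `f` extends analytically to a neighborhood of the point `ζ` of the unit circle. -/
def ExtendsNear (f : 𝔻 → ℂ) (ζ : Circle) : Prop :=
  ∃ U : Set ℂ, IsOpen U ∧ (ζ : ℂ) ∈ U ∧ ExtendsTo f (Metric.ball (0 : ℂ) 1 ∪ U)

/-- `f` is univalent: analytic and injective on the disk. -/
def IsUnivalent (f : 𝔻 → ℂ) : Prop :=
  IsAnalytic f ∧ Function.Injective f

/-- `f` is a nonconstant function. -/
def IsNonconstant (f : 𝔻 → ℂ) : Prop :=
  ¬ ∃ c : ℂ, ∀ z : 𝔻, f z = c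

/-- `φ` is an analytic selfmap of the disk. -/
def IsAnalyticSelfmap (φ : 𝔻 → 𝔻) : Prop :=
  IsAnalytic (fun z => (φ z : ℂ))

/-- `φ` is an automorphism of the disk: an analytic selfmap with an analytic inverse. -/
def IsAutomorphism (φ : 𝔻 → 𝔻) : Prop :=
  IsAnalyticSelfmap φ ∧ ∃ χ : 𝔻 → 𝔻, IsAnalyticSelfmap χ ∧
    Function.LeftInverse χ φ ∧ Function.RightInverse χ φ

/-- The composition map `f ↦ f ∘ φ`. -/
def compOp (φ : 𝔻 → 𝔻) (f : 𝔻 → ℂ) : 𝔻 → ℂ :=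
  fun z => f (φ z)

/-- The weighted composition map `f ↦ ψ · (f ∘ φ)`. -/
def weightedCompOp (ψ : 𝔻 → ℂ) (φ : 𝔻 → 𝔻) (f : 𝔻 → ℂ) : 𝔻 → ℂ :=
  fun z => ψ z * f (φ z)

/-- `T` maps the set `X` into itself and, as a map `X → X`, has a two-sided inverse. -/
def InvertibleOn (T : (𝔻 → ℂ) → (𝔻 → ℂ)) (X : Set (𝔻 → ℂ)) : Prop :=
  Set.MapsTo T X X ∧ ∃ R : (𝔻 → ℂ) → (𝔻 → ℂ), Set.MapsTo R X X ∧
    (∀ f ∈ X, R (T f) = f) ∧ (∀ f ∈ X, T (R f) = f)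

/-- `X` is automorphism invariant. -/
def AutomorphismInvariant (X : Set (𝔻 → ℂ)) : Prop :=
  ∀ f ∈ X, ∀ φ : 𝔻 → 𝔻, IsAutomorphism φ → (fun z => f (φ z)) ∈ X

/-- `g` is a multiplier of `X`. -/
def IsMultiplier (g : 𝔻 → ℂ) (X : Set (𝔻 → ℂ)) : Prop :=
  ∀ f ∈ X, (fun z => g z * f z) ∈ X

/-- There is a dense set of points of the unit circle, at each of which some member of `X`
fails to extend analytically to a neighborhood. -/
def DenselyNonextendable (X : Set (𝔻 → ℂ)) : Prop :=
  ∃ S : Set Circle, Dense S ∧ ∀ ζ ∈ S, ∃ f ∈ X, ¬ ExtendsNear f ζ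

/-- Conditions on a set `X` of analytic functions and a selfmap `φ` for composition operators. -/
structure CompHypotheses (X : Set (𝔻 → ℂ)) (φ : 𝔻 → 𝔻) : Prop where
  mapsTo : Set.MapsTo (compOp φ) X X
  exists_univalent : ∃ f ∈ X, IsUnivalent f
  exists_nonconstant : ∃ f ∈ X, IsNonconstant f ∧ AnalyticOnClosedDisk f
  nonextendable : DenselyNonextendable X

/-- Conditions on a set `X` of analytic functions, a weight `ψ` and a selfmap `φ` for weighted
composition operators. -/
structure WeightedHypotheses (X : Set (𝔻 → ℂ)) (ψ : 𝔻 → ℂ) (φ : 𝔻 → 𝔻) : Prop where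
  mapsTo : Set.MapsTo (weightedCompOp ψ φ) X X
  exists_const : ∃ c : ℂ, c ≠ 0 ∧ (fun _ : 𝔻 => c) ∈ X
  exists_translate : ∃ c : ℂ, (fun z : 𝔻 => (z : ℂ) + c) ∈ X
  nonextendable : DenselyNonextendable X

end DiskOp

namespace DiskOp

open Set Filter Topology Metric

/-! The substance is that invertibility makes `φ` onto; injectivity follows by pulling back suitable
functions. If `φ` is injective but not onto, its open image has a boundary point `w` inside the
disk. Points of the disk mapped close to `w` accumulate at some `ζ` on the circle. A member `F` of
`X` analytic across the circle is `q ∘ φ`, where `q` is a quotient of two functions analytic on the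
disk. If `q` is analytic with `q' ≠ 0` at `w`, then `q⁻¹ ∘ F` continues `φ` across an arc around
`ζ`, with values inside the disk. Every member of `X` factors through `φ` in the same way, so it
extends across that arc, against dense nonextendability (`surjective_of_forall_exists_eq`). The bad
points for `q` are isolated, and `exists_boundary_point_ne_zero` avoids them: the image of an
injective selfmap has no isolated boundary point in the disk. -/

/-! ### Injective analytic maps and their images -/

theorem isPreconnected_ball_diff_center (w : ℂ) {r : ℝ} (hr : 0 < r) :
    IsPreconnected (ball w r \ {w}) := by
  have h : ball w r \ {w} = (fun z => w + Complex.exp z) '' {z : ℂ | z.re < Real.log r} := by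
    ext y
    simp only [Set.mem_sdiff, mem_ball, dist_eq_norm, mem_singleton_iff, mem_image, mem_ofPred_eq]
    constructor
    · rintro ⟨h1, h2⟩
      have h3 : y - w ≠ 0 := sub_ne_zero.2 h2
      refine ⟨Complex.log (y - w), ?_, by rw [Complex.exp_log h3]; ring⟩
      rw [Complex.log_re]
      exact Real.log_lt_log (norm_pos_iff.2 h3) h1
    · rintro ⟨z, hz, rfl⟩
      refine ⟨?_, by simp [Complex.exp_ne_zero]⟩
      rw [add_sub_cancel_left, Complex.norm_exp]
      exact (Real.lt_log_iff_exp_lt hr).1 hz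
  rw [h]
  exact (convex_halfSpace_re_lt _).isPreconnected.image _ (by fun_prop)

/-- An injective analytic function is locally open. -/
theorem nhds_le_map_of_injOn {Φ : ℂ → ℂ} {U : Set ℂ} (hU : IsOpen U) (hΦ : AnalyticOnNhd ℂ Φ U)
    (hinj : InjOn Φ U) {z : ℂ} (hz : z ∈ U) : 𝓝 (Φ z) ≤ map Φ (𝓝 z) := by
  refine (hΦ z hz).eventually_constant_or_nhds_le_map_nhds.resolve_left fun h => ?_
  have h1 : ∀ᶠ y in 𝓝 z, y = z := by
    filter_upwards [h, hU.mem_nhds hz] with y hy hyU using hinj hyU hz hy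
  obtain ⟨y, hy1, hy2⟩ :=
    ((h1.filter_mono (nhdsWithin_le_nhds (s := {z}ᶜ))).and self_mem_nhdsWithin).exists
  exact hy2 hy1

theorem isOpen_image_of_injOn {Φ : ℂ → ℂ} {U : Set ℂ} (hU : IsOpen U)
    (hΦ : AnalyticOnNhd ℂ Φ U) (hinj : InjOn Φ U) : IsOpen (Φ '' U) := by
  rw [isOpen_iff_mem_nhds]
  rintro _ ⟨z, hz, rfl⟩
  exact nhds_le_map_of_injOn hU hΦ hinj hz (image_mem_map (hU.mem_nhds hz))

/-- The inverse of an injective analytic function is analytic. -/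
theorem exists_analytic_inverse {Φ : ℂ → ℂ} {U : Set ℂ} (hU : IsOpen U)
    (hΦ : AnalyticOnNhd ℂ Φ U) (hinj : InjOn Φ U) :
    ∃ H : ℂ → ℂ, AnalyticOnNhd ℂ H (Φ '' U) ∧ ∀ z ∈ U, H (Φ z) = z := by
  have hleft : ∀ z ∈ U, Function.invFunOn Φ U (Φ z) = z :=
    fun z hz => hinj.leftInvOn_invFunOn hz
  have hcont : ∀ z ∈ U, ContinuousAt (Function.invFunOn Φ U) (Φ z) := by
    intro z hz
    have h1 : Tendsto (Function.invFunOn Φ U) (map Φ (𝓝 z)) (𝓝 z) := by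
      rw [tendsto_map'_iff]
      refine tendsto_id.congr' ?_
      filter_upwards [hU.mem_nhds hz] with y hy using (hleft y hy).symm
    rw [ContinuousAt, hleft z hz]
    exact h1.mono_left (nhds_le_map_of_injOn hU hΦ hinj hz)
  refine ⟨Function.invFunOn Φ U, ?_, hleft⟩
  rintro _ ⟨z, hz, rfl⟩
  -- No need to show `deriv Φ z ≠ 0`: critical points are isolated, so the continuous inverse is
  -- differentiable off `Φ z`, and the singularity there is removable.
  refine Complex.analyticAt_of_differentiable_on_punctured_nhds_of_continuousAt ?_ (hcont z hz)
  have himg := isOpen_image_of_injOn hU hΦ hinj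
  have hd : ∀ᶠ y in 𝓝[≠] z, deriv Φ y ≠ 0 := by
    refine (hΦ z hz).deriv.eventually_eq_zero_or_eventually_ne_zero.resolve_left fun h => ?_
    obtain ⟨r, hr, hrU⟩ := Metric.eventually_nhds_iff_ball.1 (h.and (hU.mem_nhds hz))
    have h2 : ∀ y ∈ ball z r, Φ y = Φ z := fun y hy =>
      isOpen_ball.is_const_of_deriv_eq_zero isPreconnected_ball
        (fun x hx => (hΦ x (hrU x hx).2).differentiableAt.differentiableWithinAt)
        (fun x hx => (hrU x hx).1) hy (mem_ball_self hr)
    have h3 : (z + (r / 2 : ℝ)) ∈ ball z r := by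
      simp [abs_of_pos hr, hr]
    have := hinj (hrU _ h3).2 hz (h2 _ h3)
    simp at this
    linarith
  have ht : Tendsto (Function.invFunOn Φ U) (𝓝[≠] (Φ z)) (𝓝[≠] z) := by
    refine tendsto_nhdsWithin_iff.2 ⟨?_, ?_⟩
    · have := (hcont z hz).tendsto
      rw [hleft z hz] at this
      exact this.mono_left nhdsWithin_le_nhds
    · filter_upwards [self_mem_nhdsWithin,
        nhdsWithin_le_nhds (himg.mem_nhds (mem_image_of_mem Φ hz))] with w hw hwU
      obtain ⟨y, hy, rfl⟩ := hwU
      rw [hleft y hy]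
      rintro rfl
      exact hw rfl
  filter_upwards [ht.eventually hd, nhdsWithin_le_nhds (himg.mem_nhds (mem_image_of_mem Φ hz))]
    with w hw hwU
  obtain ⟨y, hy, rfl⟩ := hwU
  rw [hleft y hy] at hw
  refine (HasDerivAt.of_local_left_inverse (f := Φ) (f' := deriv Φ y)
    (hcont y hy) ?_ hw ?_).differentiableAt
  · rw [hleft y hy]
    exact (hΦ y hy).differentiableAt.hasDerivAt
  · filter_upwards [himg.mem_nhds (mem_image_of_mem Φ hy)] with v hv
    obtain ⟨x, hx, rfl⟩ := hv
    rw [hleft x hx]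

/-- An injective analytic selfmap of the disk omits no isolated point of the disk. -/
theorem mem_image_of_eventually_mem_image {Φ : ℂ → ℂ} (hΦ : AnalyticOnNhd ℂ Φ (ball 0 1))
    (hinj : InjOn Φ (ball 0 1)) {w : ℂ}
    (h : ∀ᶠ v in 𝓝[≠] w, v ∈ Φ '' ball 0 1) : w ∈ Φ '' ball 0 1 := by
  obtain ⟨H, hH, hleft⟩ := exists_analytic_inverse isOpen_ball hΦ hinj
  obtain ⟨r, hr, hrU⟩ := Metric.eventually_nhds_iff_ball.1 (eventually_nhdsWithin_iff.1 h)
  have hmem : ∀ v ∈ ball w r, v ≠ w → ‖H v‖ < 1 ∧ Φ (H v) = v := by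
    intro v hv hne
    obtain ⟨y, hy, rfl⟩ := hrU v hv hne
    rw [hleft y hy]
    exact ⟨by simpa using hy, rfl⟩
  -- The inverse is bounded by 1 near `w`, so it extends analytically over `w`.
  have hd := Complex.differentiableOn_update_limUnder_of_bddAbove (f := H) (ball_mem_nhds w hr)
    (fun v hv => (hH v (hrU v hv.1 hv.2)).differentiableAt.differentiableWithinAt)
    ⟨1, by rintro _ ⟨v, hv, rfl⟩; exact (hmem v hv.1 hv.2).1.le⟩
  set E := Function.update H w (limUnder (𝓝[≠] w) H) with hE
  have hEv : ∀ v, v ≠ w → E v = H v := fun v hv => Function.update_of_ne hv _ _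
  have hc : ContinuousAt E w :=
    (hd.differentiableAt (ball_mem_nhds w hr)).continuousAt
  have hpun : ∀ᶠ v in 𝓝[≠] w, ‖E v‖ < 1 ∧ Φ (E v) = v := by
    filter_upwards [self_mem_nhdsWithin, nhdsWithin_le_nhds (ball_mem_nhds w hr)] with v hv hvr
    rw [hEv v hv]
    exact hmem v hvr hv
  have htend : Tendsto E (𝓝[≠] w) (𝓝 (E w)) := hc.tendsto.mono_left nhdsWithin_le_nhds
  have hle : ‖E w‖ ≤ 1 := le_of_tendsto htend.norm (hpun.mono fun v hv => hv.1.le)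
  have hlt : ‖E w‖ < 1 := by
    refine lt_of_le_of_ne hle fun heq => ?_
    -- Modulus 1 at `w` would make `E` locally constant by the maximum principle, yet `‖E v‖ < 1`
    -- for nearby `v ≠ w`.
    have hmax : IsLocalMax (norm ∘ E) w := by
      have h1 := eventually_nhdsWithin_iff.1 hpun
      filter_upwards [h1] with v hv
      by_cases hvw : v = w
      · rw [hvw]
      · simpa [heq] using (hv hvw).1.le
    have hconst := Complex.eventually_eq_of_isLocalMax_norm
      (by filter_upwards [ball_mem_nhds w hr] with v hv using
        hd.differentiableAt (isOpen_ball.mem_nhds hv)) hmax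
    obtain ⟨v, hv1, hv2⟩ := ((hconst.filter_mono nhdsWithin_le_nhds).and hpun).exists
    rw [hv1, heq] at hv2
    exact lt_irrefl _ hv2.1
  have hb : E w ∈ ball (0 : ℂ) 1 := by simpa using hlt
  refine ⟨E w, hb, ?_⟩
  have h1 : Tendsto (fun v => Φ (E v)) (𝓝[≠] w) (𝓝 (Φ (E w))) :=
    (hΦ _ hb).continuousAt.tendsto.comp htend
  have h2 : Tendsto (fun v => Φ (E v)) (𝓝[≠] w) (𝓝 w) :=
    (tendsto_id.mono_left nhdsWithin_le_nhds).congr' (hpun.mono fun v hv => hv.2.symm)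
  exact tendsto_nhds_unique h1 h2

/-! ### Continuation of the symbol across an arc -/

/-- A boundary point of the image of a non-surjective injective analytic selfmap of the disk can be
chosen off the zero set of a given nonzero analytic function. -/
theorem exists_boundary_point_ne_zero {Φ P : ℂ → ℂ} (hΦ : AnalyticOnNhd ℂ Φ (ball 0 1))
    (hmaps : MapsTo Φ (ball 0 1) (ball 0 1))
    (hinj : InjOn Φ (ball 0 1)) (hns : ¬ ball 0 1 ⊆ Φ '' ball 0 1)
    (hP : AnalyticOnNhd ℂ P (ball 0 1)) (hP0 : ∃ z ∈ ball (0 : ℂ) 1, P z ≠ 0) :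
    ∃ w ∈ ball (0 : ℂ) 1, w ∈ closure (Φ '' ball 0 1) ∧ w ∉ Φ '' ball 0 1 ∧ P w ≠ 0 := by
  have hopen := isOpen_image_of_injOn isOpen_ball hΦ hinj
  by_contra! hcon
  refine hns (isPreconnected_ball.subset_of_closure_inter_subset hopen ?_ ?_)
  · have h0 : (0 : ℂ) ∈ ball (0 : ℂ) 1 := mem_ball_self one_pos
    exact ⟨Φ 0, hmaps h0, 0, h0, rfl⟩
  · rintro w ⟨hwc, hwB⟩
    by_contra hw
    have hPn : ∀ᶠ v in 𝓝[≠] w, P v ≠ 0 := by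
      refine (hP w hwB).eventually_eq_zero_or_eventually_ne_zero.resolve_left fun h => ?_
      obtain ⟨z, hz, hPz⟩ := hP0
      exact hPz (hP.eqOn_zero_of_preconnected_of_eventuallyEq_zero isPreconnected_ball hwB h hz)
    obtain ⟨r, hr, hrP⟩ := Metric.eventually_nhds_iff_ball.1
      ((eventually_nhdsWithin_iff.1 hPn).and (isOpen_ball.mem_nhds hwB))
    -- Zeros of `P` are isolated, so no boundary point other than `w` lies in this ball; the
    -- connected punctured ball meets the image and hence lies in it.
    have hsub : ball w r \ {w} ⊆ Φ '' ball 0 1 := by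
      refine (isPreconnected_ball_diff_center w hr).subset_of_closure_inter_subset hopen ?_ ?_
      · obtain ⟨v, hv, hvΦ⟩ := mem_closure_iff_nhds.1 hwc _ (ball_mem_nhds w hr)
        exact ⟨v, ⟨hv, fun h => hw (h ▸ hvΦ)⟩, hvΦ⟩
      · rintro v ⟨hvc, hvr, hvw⟩
        by_contra hv
        exact (hrP v hvr).1 hvw (hcon v (hrP v hvr).2 hvc hv)
    refine hw (mem_image_of_eventually_mem_image hΦ hinj ?_)
    filter_upwards [self_mem_nhdsWithin, nhdsWithin_le_nhds (ball_mem_nhds w hr)] with v hv hvr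
    exact hsub ⟨hvr, hv⟩

/-- If `F = (G₂ / G₁) ∘ Φ` with `F` analytic across the circle and nonconstant, and `Φ` is an
injective selfmap of the disk which is not onto, then `Φ` extends across some arc of the circle,
with values in the part of the disk where `G₁` does not vanish. -/
theorem exists_extension_across_arc {Φ F G₁ G₂ : ℂ → ℂ} (hΦ : AnalyticOnNhd ℂ Φ (ball 0 1))
    (hmaps : MapsTo Φ (ball 0 1) (ball 0 1))
    (hinj : InjOn Φ (ball 0 1)) (hns : ¬ ball 0 1 ⊆ Φ '' ball 0 1)
    (hG₁ : AnalyticOnNhd ℂ G₁ (ball 0 1)) (hG₂ : AnalyticOnNhd ℂ G₂ (ball 0 1))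
    (hF : AnalyticOnNhd ℂ F (closedBall 0 1)) (hne : ∀ z ∈ ball (0 : ℂ) 1, G₁ (Φ z) ≠ 0)
    (heq : ∀ z ∈ ball (0 : ℂ) 1, G₂ (Φ z) = F z * G₁ (Φ z))
    (hF' : ∃ z ∈ ball (0 : ℂ) 1, deriv F z ≠ 0) :
    ∃ ζ : ℂ, ‖ζ‖ = 1 ∧ ∃ r > 0, ∃ K : ℂ → ℂ, AnalyticOnNhd ℂ K (ball ζ r) ∧
      (∀ z ∈ ball ζ r, K z ∈ ball (0 : ℂ) 1 ∧ G₁ (K z) ≠ 0) ∧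
      ∀ z ∈ ball ζ r ∩ ball 0 1, K z = Φ z := by
  set q : ℂ → ℂ := fun w => G₂ w / G₁ w with hq
  have hqF : ∀ z ∈ ball (0 : ℂ) 1, q (Φ z) = F z := fun z hz => by
    rw [hq]; simp only []; rw [heq z hz, mul_div_cancel_right₀ _ (hne z hz)]
  have hqan : ∀ w ∈ ball (0 : ℂ) 1, G₁ w ≠ 0 → AnalyticAt ℂ q w :=
    fun w hw h => (hG₂ w hw).div (hG₁ w hw) h
  have hqd : ∀ w ∈ ball (0 : ℂ) 1, G₁ w ≠ 0 →
      deriv q w = (deriv G₂ w * G₁ w - G₂ w * deriv G₁ w) / G₁ w ^ 2 := fun w hw h =>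
    deriv_fun_div (hG₂ w hw).differentiableAt (hG₁ w hw).differentiableAt h
  obtain ⟨w, hwB, hwc, hwn, hPw⟩ := exists_boundary_point_ne_zero
    -- `P` is `G₁` times the numerator of `q'`, so `P w ≠ 0` makes `q` analytic and locally
    -- invertible at `w`.
    (P := fun w => G₁ w * (deriv G₂ w * G₁ w - G₂ w * deriv G₁ w)) hΦ hmaps hinj hns
    (fun w hw => (hG₁ w hw).mul (((hG₂ w hw).deriv.mul (hG₁ w hw)).sub
      ((hG₂ w hw).mul (hG₁ w hw).deriv))) (by
      obtain ⟨z, hz, hFz⟩ := hF'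
      refine ⟨Φ z, hmaps hz, mul_ne_zero (hne z hz) fun h0 => hFz ?_⟩
      have h1 : F =ᶠ[𝓝 z] q ∘ Φ := by
        filter_upwards [isOpen_ball.mem_nhds hz] with y hy using (hqF y hy).symm
      rw [h1.deriv_eq, deriv_comp z (hqan _ (hmaps hz) (hne z hz)).differentiableAt
        (hΦ z hz).differentiableAt, hqd _ (hmaps hz) (hne z hz), h0]
      simp)
  have hG₁w : G₁ w ≠ 0 := left_ne_zero_of_mul hPw
  have hqw : AnalyticAt ℂ q w := hqan w hwB hG₁w
  have hqw' : deriv q w ≠ 0 := by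
    rw [hqd w hwB hG₁w]
    exact div_ne_zero (right_ne_zero_of_mul hPw) (pow_ne_zero _ hG₁w)
  obtain ⟨R, hRan, hRleft⟩ : ∃ R : ℂ → ℂ, AnalyticAt ℂ R (q w) ∧ ∀ᶠ v in 𝓝 w, R (q v) = v :=
    ⟨_, hqw.analyticAt_localInverse hqw', hqw.hasStrictDerivAt.eventually_left_inverse hqw'⟩
  obtain ⟨u, hu, huw⟩ := mem_closure_iff_seq_limit.1 hwc
  choose z hzB hzu using hu
  obtain ⟨ζ, hζ, s, hs, hzζ⟩ := (isCompact_closedBall (0 : ℂ) 1).tendsto_subseq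
    (fun n => ball_subset_closedBall (hzB n))
  have hΦz : Tendsto (fun n => Φ (z (s n))) atTop (𝓝 w) := by
    simpa only [hzu, Function.comp_def] using huw.comp hs.tendsto_atTop
  have hζ1 : ‖ζ‖ = 1 := by
    refine le_antisymm (by simpa using hζ) (not_lt.1 fun hlt => ?_)
    have hζB : ζ ∈ ball (0 : ℂ) 1 := by simpa using hlt
    exact hwn ⟨ζ, hζB,
      tendsto_nhds_unique ((hΦ ζ hζB).continuousAt.tendsto.comp hzζ) hΦz⟩
  have hFζ : F ζ = q w := by
    refine tendsto_nhds_unique ((hF ζ hζ).continuousAt.tendsto.comp hzζ) ?_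
    refine (hqw.continuousAt.tendsto.comp hΦz).congr fun n => ?_
    exact hqF _ (hzB _)
  have hKan : AnalyticAt ℂ (R ∘ F) ζ := AnalyticAt.comp (by rwa [hFζ]) (hF ζ hζ)
  have hKζ : (R ∘ F) ζ = w := by
    simp only [Function.comp_apply, hFζ]
    exact hRleft.self_of_nhds
  have hKnear : ∀ᶠ y in 𝓝 ζ, (R ∘ F) y ∈ ball (0 : ℂ) 1 ∧ G₁ ((R ∘ F) y) ≠ 0 := by
    have h1 := hKan.continuousAt.tendsto
    rw [hKζ] at h1
    exact h1.eventually (Filter.Eventually.and (isOpen_ball.mem_nhds hwB)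
      ((hG₁ w hwB).continuousAt.eventually_ne hG₁w))
  obtain ⟨r, hr, hrK⟩ := Metric.eventually_nhds_iff_ball.1
    (hKan.eventually_analyticAt.and hKnear)
  refine ⟨ζ, hζ1, r, hr, R ∘ F, fun y hy => (hrK y hy).1, fun y hy => (hrK y hy).2, ?_⟩
  -- `R ∘ F = Φ` is clear only near points that `Φ` sends close to `w`; the identity theorem spreads
  -- it over the convex lens.
  obtain ⟨n, hn1, hn2⟩ := ((hzζ.eventually (ball_mem_nhds ζ hr)).and
    (hΦz.eventually hRleft.eventually_nhds)).exists
  refine AnalyticOnNhd.eqOn_of_preconnected_of_eventuallyEq (𝕜 := ℂ) (z₀ := z (s n))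
    (fun y hy => (hrK y hy.1).1) (fun y hy => hΦ y hy.2)
    ((convex_ball _ _).inter (convex_ball _ _)).isPreconnected ⟨hn1, hzB _⟩ ?_
  filter_upwards [(hΦ _ (hzB (s n))).continuousAt.eventually hn2,
    isOpen_ball.mem_nhds (hzB (s n))] with y hy hyB
  rw [Function.comp_apply, ← hqF y hyB, hy]

/-! ### Transfer to functions on `𝔻`, and surjectivity of the symbol -/

theorem coe_mem_ball (z : 𝔻) : (z : ℂ) ∈ ball (0 : ℂ) 1 := by
  simpa using z.norm_lt_one

theorem exists_coe_eq {z : ℂ} (hz : z ∈ ball (0 : ℂ) 1) : ∃ x : 𝔻, (x : ℂ) = z :=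
  ⟨Complex.UnitDisc.mk z (by simpa using hz), rfl⟩

/-- A bijective analytic selfmap of the disk is an automorphism. -/
theorem isAutomorphism_of_bijective {φ : 𝔻 → 𝔻} (hφ : IsAnalyticSelfmap φ)
    (hb : Function.Bijective φ) : IsAutomorphism φ := by
  obtain ⟨Φ, hΦ, hΦφ⟩ := id hφ
  have hinj : InjOn Φ (ball 0 1) := by
    intro x hx y hy hxy
    obtain ⟨x, rfl⟩ := exists_coe_eq hx
    obtain ⟨y, rfl⟩ := exists_coe_eq hy
    rw [hΦφ, hΦφ, Complex.UnitDisc.coe_inj] at hxy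
    rw [hb.1 hxy]
  obtain ⟨H, hH, hleft⟩ := exists_analytic_inverse isOpen_ball hΦ hinj
  obtain ⟨χ, hχ1, hχ2⟩ := Function.bijective_iff_has_inverse.1 hb
  refine ⟨hφ, χ, ⟨H, fun z hz => hH z ?_, fun z => ?_⟩, hχ1, hχ2⟩
  · obtain ⟨x, rfl⟩ := exists_coe_eq hz
    exact ⟨χ x, coe_mem_ball _, by simp only [hΦφ, hχ2 x]⟩
  · have h := hleft _ (coe_mem_ball (χ z))
    simpa only [hΦφ, hχ2 z] using h

/-- Functions which agree with `k` on the part of the disk near `ζ` extend near `ζ`. -/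
theorem extendsNear_of_eqOn {f : 𝔻 → ℂ} (hf : IsAnalytic f) {N : Set ℂ} (hN : IsOpen N)
    {k : ℂ → ℂ} (hk : AnalyticOnNhd ℂ k N) (heq : ∀ z : 𝔻, (z : ℂ) ∈ N → k z = f z)
    {ζ : Circle} (hζ : (ζ : ℂ) ∈ N) : ExtendsNear f ζ := by
  classical
  obtain ⟨F, hF, hFf⟩ := hf
  refine ⟨N, hN, hζ, fun z => if z ∈ ball (0 : ℂ) 1 then F z else k z, ?_, fun z => ?_⟩
  · rintro z (hz | hz)
    · refine (hF z hz).congr ?_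
      filter_upwards [isOpen_ball.mem_nhds hz] with y hy
      rw [if_pos hy]
    · refine (hk z hz).congr ?_
      filter_upwards [hN.mem_nhds hz] with y hy
      split_ifs with h
      · obtain ⟨x, rfl⟩ := exists_coe_eq h
        rw [heq x hy, hFf]
      · rfl
  · simp only [if_pos (coe_mem_ball z), hFf]

/-- An injective symbol is onto when every member of a densely nonextendable set of analytic
functions has the form `ψ · (g ∘ φ)`, with suitable normalizations. -/
theorem surjective_of_forall_exists_eq {X : Set (𝔻 → ℂ)} (hX : ∀ f ∈ X, IsAnalytic f)
    (hS : DenselyNonextendable X) {φ : 𝔻 → 𝔻} (hφ : IsAnalyticSelfmap φ)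
    (hinj : Function.Injective φ) {ψ : 𝔻 → ℂ}
    (hsurj : ∀ f ∈ X, ∃ g, IsAnalytic g ∧ weightedCompOp ψ φ g = f)
    {g₁ g₂ f : 𝔻 → ℂ} (hg₁ : IsAnalytic g₁) (hg₂ : IsAnalytic g₂)
    (hf : AnalyticOnClosedDisk f) (hfc : IsNonconstant f)
    (h₁ : ∀ z, weightedCompOp ψ φ g₁ z = 1) (h₂ : weightedCompOp ψ φ g₂ = f) :
    Function.Surjective φ := by
  obtain ⟨Φ, hΦ, hΦφ⟩ := id hφ
  obtain ⟨G₁, hG₁, hG₁g⟩ := id hg₁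
  obtain ⟨G₂, hG₂, hG₂g⟩ := id hg₂
  obtain ⟨U, hU, hUB, F, hF, hFf⟩ := hf
  have hg₁ne : ∀ z, g₁ (φ z) ≠ 0 := fun z h => by
    have := h₁ z
    simp [weightedCompOp, h] at this
  by_contra hns
  obtain ⟨ζ, hζ, r, hr, K, hK, hKmem, hKΦ⟩ := exists_extension_across_arc (F := F) hΦ
    (fun z hz => by
      obtain ⟨x, rfl⟩ := exists_coe_eq hz
      rw [hΦφ]
      exact coe_mem_ball _)
    (fun x hx y hy hxy => by
      obtain ⟨x, rfl⟩ := exists_coe_eq hx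
      obtain ⟨y, rfl⟩ := exists_coe_eq hy
      rw [hΦφ, hΦφ, Complex.UnitDisc.coe_inj] at hxy
      rw [hinj hxy])
    (fun hsub => hns fun w => by
      obtain ⟨x, hx, hxw⟩ := hsub (coe_mem_ball w)
      obtain ⟨x, rfl⟩ := exists_coe_eq hx
      rw [hΦφ, Complex.UnitDisc.coe_inj] at hxw
      exact ⟨x, hxw⟩)
    hG₁ hG₂ (hF.mono hUB)
    (fun z hz => by
      obtain ⟨x, rfl⟩ := exists_coe_eq hz
      rw [hΦφ, hG₁g]
      exact hg₁ne x)
    (fun z hz => by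
      obtain ⟨x, rfl⟩ := exists_coe_eq hz
      rw [hΦφ, hG₁g, hG₂g, hFf, ← h₂]
      have := h₁ x
      simp only [weightedCompOp] at this ⊢
      linear_combination (-g₂ (φ x)) * this)
    (by
      by_contra! hcon
      refine hfc ⟨F 0, fun z => ?_⟩
      rw [← hFf z]
      exact isOpen_ball.is_const_of_deriv_eq_zero isPreconnected_ball
        (fun x hx => (hF x (hUB (ball_subset_closedBall hx))).differentiableAt.differentiableWithinAt)
        (fun x hx => hcon x hx) (coe_mem_ball z) (mem_ball_self one_pos))
  obtain ⟨S, hSd, hSX⟩ := hS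
  obtain ⟨η, hηS, hη⟩ := hSd.inter_open_nonempty {x : Circle | (x : ℂ) ∈ ball ζ r}
    (isOpen_ball.preimage continuous_subtype_val)
    ⟨⟨ζ, mem_sphere_zero_iff_norm.2 hζ⟩, mem_ball_self hr⟩
  obtain ⟨f, hfX, hfn⟩ := hSX η hη
  obtain ⟨g, ⟨G, hG, hGg⟩, hgf⟩ := hsurj f hfX
  -- By `h₁`, `ψ = 1 / (g₁ ∘ φ)`, so `f = (g / g₁) ∘ φ`, which continues once `φ` does.
  refine hfn (extendsNear_of_eqOn (hX f hfX) isOpen_ball (k := fun z => G (K z) / G₁ (K z))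
    (fun z hz => ?_) (fun z hz => ?_) hηS)
  · exact ((hG _ (hKmem z hz).1).comp (hK z hz)).div ((hG₁ _ (hKmem z hz).1).comp (hK z hz))
      (hKmem z hz).2
  · rw [hKΦ z ⟨hz, coe_mem_ball z⟩, hΦφ, hGg, hG₁g, div_eq_iff (hg₁ne z), ← hgf]
    have := h₁ z
    simp only [weightedCompOp] at this ⊢
    linear_combination (-g (φ z)) * this

theorem isAnalytic_const (c : ℂ) : IsAnalytic fun _ => c :=
  ⟨fun _ => c, analyticOnNhd_const, fun _ => rfl⟩

theorem isNonconstant_of_injective {f : 𝔻 → ℂ} (hf : Function.Injective f) : IsNonconstant f := by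
  rintro ⟨c, hc⟩
  have h : (0 : 𝔻) = Complex.UnitDisc.mk (1 / 2) (by norm_num) :=
    hf ((hc _).trans (hc _).symm)
  rw [← Complex.UnitDisc.coe_inj] at h
  norm_num at h

/-! ### The two characterizations -/

theorem invertibleOn_compOp_iff {X : Set (𝔻 → ℂ)} (hX : ∀ f ∈ X, IsAnalytic f)
    (hinv : AutomorphismInvariant X) {φ : 𝔻 → 𝔻} (hφ : IsAnalyticSelfmap φ)
    (h : CompHypotheses X φ) : InvertibleOn (compOp φ) X ↔ IsAutomorphism φ := by
  constructor
  · rintro ⟨-, R, hR, -, hTR⟩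
    have hinj : Function.Injective φ := by
      obtain ⟨f, hfX, -, hfi⟩ := h.exists_univalent
      intro x y hxy
      refine hfi ?_
      rw [← hTR f hfX]
      simp only [compOp, hxy]
    obtain ⟨f, hfX, hfc, hf⟩ := h.exists_nonconstant
    have hone : ∀ g, weightedCompOp (fun _ => 1) φ g = compOp φ g := fun g => by
      funext z
      simp [weightedCompOp, compOp]
    exact isAutomorphism_of_bijective hφ ⟨hinj, surjective_of_forall_exists_eq
      (ψ := fun _ => 1) hX h.nonextendable hφ hinj
      (fun k hk => ⟨R k, hX _ (hR hk), (hone _).trans (hTR k hk)⟩)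
      (isAnalytic_const 1) (hX _ (hR hfX)) hf hfc (fun z => by simp [weightedCompOp])
      ((hone _).trans (hTR f hfX))⟩
  · rintro ⟨-, χ, hχ, hl, hr⟩
    refine ⟨h.mapsTo, compOp χ, fun f hf => hinv f hf χ ⟨hχ, φ, hφ, hr, hl⟩,
      fun f _ => funext fun z => ?_, fun f _ => funext fun z => ?_⟩
    · simp only [compOp, hr z]
    · simp only [compOp, hl z]

theorem invertibleOn_weightedCompOp_iff {X : Set (𝔻 → ℂ)} (hX : ∀ f ∈ X, IsAnalytic f)
    (hinv : AutomorphismInvariant X) {φ : 𝔻 → 𝔻} (hφ : IsAnalyticSelfmap φ) {ψ : 𝔻 → ℂ}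
    (h : WeightedHypotheses X ψ φ) :
    InvertibleOn (weightedCompOp ψ φ) X ↔ IsAutomorphism φ ∧ IsMultiplier ψ X ∧
      (∀ z : 𝔻, ψ z ≠ 0) ∧ IsMultiplier (fun z => 1 / ψ z) X := by
  constructor
  · rintro ⟨hT, R, hR, -, hTR⟩
    obtain ⟨c, hc, hcX⟩ := h.exists_const
    obtain ⟨b, hbX⟩ := h.exists_translate
    have hTc : ∀ z, ψ z * R (fun _ => c) (φ z) = c := fun z => congrFun (hTR _ hcX) z
    have hTb : ∀ z : 𝔻, ψ z * R (fun z : 𝔻 => (z : ℂ) + b) (φ z) = z + b :=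
      fun z => congrFun (hTR _ hbX) z
    have hψ : ∀ z, ψ z ≠ 0 := fun z h0 => hc (by rw [← hTc z, h0, zero_mul])
    have hinj : Function.Injective φ := by
      intro x y hxy
      -- The preimage of a constant shows that `ψ` depends only on `φ`; the preimage of `z + b` then
      -- separates points.
      have hψxy : ψ x = ψ y := by
        have hx := hTc x
        rw [hxy] at hx
        have hne : R (fun _ => c) (φ y) ≠ 0 := fun h0 => hc (by rw [← hTc y, h0, mul_zero])
        exact mul_right_cancel₀ hne (hx.trans (hTc y).symm)
      have hx := hTb x
      rw [hxy, hψxy, hTb y] at hx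
      exact (Complex.UnitDisc.coe_injective (add_right_cancel hx)).symm
    have hsurj : Function.Surjective φ := by
      refine surjective_of_forall_exists_eq (ψ := ψ) (g₁ := fun z => c⁻¹ * R (fun _ => c) z)
        (f := fun z : 𝔻 => (z : ℂ) + b) hX h.nonextendable hφ hinj
        (fun k hk => ⟨R k, hX _ (hR hk), hTR k hk⟩) ?_ (hX _ (hR hbX)) ?_ ?_ ?_ (hTR _ hbX)
      · obtain ⟨G, hG, hGg⟩ := hX _ (hR hcX)
        exact ⟨fun z => c⁻¹ * G z, fun z hz => analyticAt_const.mul (hG z hz),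
          fun z => by simp only [hGg]⟩
      · exact ⟨univ, isOpen_univ, subset_univ _, fun z => z + b,
          fun z _ => analyticAt_id.add analyticAt_const, fun _ => rfl⟩
      · exact isNonconstant_of_injective fun x y hxy =>
          Complex.UnitDisc.coe_injective (add_right_cancel hxy)
      · intro z
        have := hTc z
        simp only [weightedCompOp]
        field_simp
        linear_combination this
    have haut := isAutomorphism_of_bijective hφ ⟨hinj, hsurj⟩
    refine ⟨haut, fun f hf => ?_, hψ, fun f hf => ?_⟩
    -- `ψ f` is the image of `f ∘ φ⁻¹`, and `f / ψ` below is `(R f) ∘ φ`.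
    · obtain ⟨-, χ, hχ, hl, hr⟩ := id haut
      have hmem := hT (hinv f hf χ ⟨hχ, φ, hφ, hr, hl⟩)
      simpa only [funext fun z => show weightedCompOp ψ φ (fun z => f (χ z)) z = ψ z * f z by
        simp only [weightedCompOp, hl z]] using hmem
    · have hmem := hinv _ (hR hf) φ haut
      convert hmem using 2 with z
      have := congrFun (hTR f hf) z
      simp only [← this, weightedCompOp, one_div, inv_mul_cancel_left₀ (hψ z)]
  · rintro ⟨⟨-, χ, hχ, hl, hr⟩, -, hψ, hmul⟩
    refine ⟨h.mapsTo, fun f z => 1 / ψ (χ z) * f (χ z),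
      fun f hf => hinv _ (hmul f hf) χ ⟨hχ, φ, hφ, hr, hl⟩,
      fun f _ => funext fun z => ?_, fun f _ => funext fun z => ?_⟩
    · simp only [weightedCompOp, hr z, one_div, inv_mul_cancel_left₀ (hψ _)]
    · simp only [weightedCompOp, hl z, one_div, mul_inv_cancel_left₀ (hψ _)]

end DiskOp

/-- On an automorphism-invariant set `X` of analytic functions on the disk, invertibility of
composition and of weighted composition operators is characterized. That `1 / ψ` is a multiplier
includes that it is a function on the disk, i.e. that `ψ` has no zero. -/
theorem mainTheorem3 (X : Set (𝔻 → ℂ)) (hX : ∀ f ∈ X, DiskOp.IsAnalytic f)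
    (hinv : DiskOp.AutomorphismInvariant X)
    (φ : 𝔻 → 𝔻) (hφ : DiskOp.IsAnalyticSelfmap φ) :
    (DiskOp.CompHypotheses X φ →
      (DiskOp.InvertibleOn (DiskOp.compOp φ) X ↔ DiskOp.IsAutomorphism φ)) ∧
    (∀ ψ : 𝔻 → ℂ, DiskOp.IsAnalytic ψ → DiskOp.WeightedHypotheses X ψ φ →
      (DiskOp.InvertibleOn (DiskOp.weightedCompOp ψ φ) X ↔
        DiskOp.IsAutomorphism φ ∧ DiskOp.IsMultiplier ψ X ∧
          (∀ z : 𝔻, ψ z ≠ 0) ∧ DiskOp.IsMultiplier (fun z => 1 / ψ z) X)) :=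
  ⟨fun h => DiskOp.invertibleOn_compOp_iff hX hinv hφ h,
    fun _ _ h => DiskOp.invertibleOn_weightedCompOp_iff hX hinv hφ h⟩
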